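/- Let $m,n\in\mathbb N$. For $i=1,\dots,m$ let $f_i:\mathbb R^n\to\mathbb R$ be convex and let $X_i\subset\mathbb R^n$ be compact and convex, such that $\bigcap_{i=1}^m X_i$ has non-empty interior and the subgradients of $f=\sum_{i=1}^m f_i$ are bounded on $\bigcup_{i=1}^m X_i$, i.e. $\sup\{\|\xi\|_2:\ \xi\in\partial f(x),\ x\in\bigcup_{i=1}^m X_i\}<\infty$. Let $x^\star$ denote a minimiser of $f$ over $\bigcap_{i=1}^m X_i$. Let $(A(k))_{k\ge 0}$ be doubly stochastic real $m\times m$ matrices, $[A(k)]_j^i$ being the entry in row $j$ and column $i$, for which there are $\theta\in(0,1)$ and $T\in\mathbb N$ such that: for all $k,i,j$, $[A(k)]_i^i\ge\theta$, and $[A(k)]_j^i\ge\theta$ whenever $[A(k)]_j^i>0$; the graph $(\{1,\dots,m\},\mathcal E_\infty)$, where $(j,i)\in\mathcal E_\infty$ iff $[A(k)]_j^i>0$ for infinitely many $k$, is strongly connected; and for every $(j,i)\in\mathcal E_\infty$ and every $k\ge 0$ there is $l\in\{k,\dots,k+T-1\}$ with $[A(l)]_j^i>0$. Let $\eta>0$,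 $c(k)=\eta/\sqrt{k+1}$, and let $x_i(k)$, $k\ge 0$, $i=1,\dots,m$, be generated by: $x_i(0)\in X_i$ arbitrary and, for $k\ge0$, $$z_i(k)=\sum_{j=1}^m[A(k)]_j^i\,x_j(k),\qquad g_i(k)\in\partial f_i(z_i(k)),\qquad d_i(k)=\sum_{j=1}^m[A(k)]_j^i\,g_j(k),$$ $$x_i(k+1)=\operatorname*{arg\,min}_{\xi\in X_i}\ d_i(k)^{\mathsf T}\xi+\frac1{2c(k)}\|z_i(k)-\xi\|_2^2 .$$ Put $S(k)=\sum_{r=1}^k c(r)$, $\hat x_i(0)=x_i(0)$ and $\hat x_i(k+1)=\dfrac{c(k+1)\,x_i(k+1)+S(k)\,\hat x_i(k)}{S(k+1)}$. Then: (i) for all $i,j$, $\|\hat x_i(k)-\hat x_j(k)\|_2\to0$ as $k\to\infty$, and $\|\hat x_i(k)-\hat x_j(k)\|_2=O\!\left(\frac{\ln k}{\sqrt k}\right)$; (ii) for all $i$, every accumulation point of $(\hat x_i(k))_k$ lies in $\bigcap_{j=1}^m X_j$; (iii) there exist $B_1,B_2>0$, depending only on the $f_i$, the $X_i$, $\eta$,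 $\theta$ and $T$ (not on the matrices, the initial points or the choice of subgradients), such that for all $k\ge1$ and every minimiser $x^\star$, $$\left|\sum_{i=1}^m f_i(\hat x_i(k))-f(x^\star)\right|\le \frac{B_1}{\sqrt k}+B_2\,\frac{\ln k}{\sqrt k}.$$ -/

import Mathlib

open Filter Topology Asymptotics

noncomputable section

namespace DistributedSubgradient

/-- The convex subdifferential of a finite function `f` at `x`. -/
def subdifferential {n : ℕ} (f : EuclideanSpace ℝ (Fin n) → ℝ) (x : EuclideanSpace ℝ (Fin n)) :
    Set (EuclideanSpace ℝ (Fin n)) :=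
  {ξ | ∀ y, f x + inner ℝ ξ (y - x) ≤ f y}

/-- The global objective `f = ∑ i, f i`. -/
def objective {n m : ℕ} (f : Fin m → EuclideanSpace ℝ (Fin n) → ℝ)
    (x : EuclideanSpace ℝ (Fin n)) : ℝ :=
  ∑ i, f i x

/-- The standing assumptions on the problem
`minimise ∑ i, f i x` subject to `x ∈ ⋂ i, X i`. -/
structure ConvexCompactProblem {n m : ℕ} (f : Fin m → EuclideanSpace ℝ (Fin n) → ℝ)
    (X : Fin m → Set (EuclideanSpace ℝ (Fin n))) : Prop where
  convex_objective : ∀ i, ConvexOn ℝ Set.univ (f i)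
  compact_constraint : ∀ i, IsCompact (X i)
  convex_constraint : ∀ i, Convex ℝ (X i)
  interior_nonempty : (interior (⋂ i, X i)).Nonempty
  bounded_subgradient : ∃ L : ℝ, ∀ x ∈ ⋃ i, X i, ∀ ξ ∈ subdifferential (objective f) x, ‖ξ‖ ≤ L

/-- `xstar` is an optimiser: a feasible point that minimises the objective over the feasible set. -/
def IsOptimiser {n m : ℕ} (f : Fin m → EuclideanSpace ℝ (Fin n) → ℝ)
    (X : Fin m → Set (EuclideanSpace ℝ (Fin n))) (xstar : EuclideanSpace ℝ (Fin n)) : Prop :=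
  xstar ∈ ⋂ i, X i ∧ ∀ x ∈ ⋂ i, X i, objective f xstar ≤ objective f x

/-- Agent `j` communicates with agent `i` at time `k`; the entry of `A k` in row `j` and
column `i` is the weight that `i` gives to the information of `j`. -/
def Communicates {m : ℕ} (A : ℕ → Matrix (Fin m) (Fin m) ℝ) (k : ℕ) (j i : Fin m) : Prop :=
  0 < A k j i

/-- `(j, i)` is an edge of the limiting graph: `j` communicates with `i` infinitely often. -/
def CommunicatesInfinitelyOften {m : ℕ} (A : ℕ → Matrix (Fin m) (Fin m) ℝ) (j i : Fin m) : Prop :=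
  ∃ᶠ k in atTop, Communicates A k j i

/-- The assumptions on the time-varying network, with lower bound `θ` on the positive weights
and uniform upper bound `T` on the communication times. -/
structure NetworkAssumptions {m : ℕ} (A : ℕ → Matrix (Fin m) (Fin m) ℝ) (θ : ℝ) (T : ℕ) :
    Prop where
  strongly_connected : ∀ j i, Relation.ReflTransGen (CommunicatesInfinitelyOften A) j i
  bounded_communication : ∀ j i, CommunicatesInfinitelyOften A j i →
    ∀ k, ∃ l, k ≤ l ∧ l < k + T ∧ Communicates A l j i
  diagonal_lower_bound : ∀ k i, θ ≤ A k i i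
  positive_lower_bound : ∀ k j i, 0 < A k j i → θ ≤ A k j i
  doubly_stochastic : ∀ k, A k ∈ doublyStochastic ℝ (Fin m)

/-- The sequences `x, z, g, d` (time first, then agent) are generated by the
subgradient averaging algorithm with weights `A` and step sizes `c`. -/
structure IsAlgorithmRun {n m : ℕ} (f : Fin m → EuclideanSpace ℝ (Fin n) → ℝ)
    (X : Fin m → Set (EuclideanSpace ℝ (Fin n))) (A : ℕ → Matrix (Fin m) (Fin m) ℝ) (c : ℕ → ℝ)
    (x z g d : ℕ → Fin m → EuclideanSpace ℝ (Fin n)) : Prop where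
  init : ∀ i, x 0 i ∈ X i
  average : ∀ k i, z k i = ∑ j, A k j i • x k j
  subgradient : ∀ k i, g k i ∈ subdifferential (f i) (z k i)
  average_subgradient : ∀ k i, d k i = ∑ j, A k j i • g k j
  update_mem : ∀ k i, x (k + 1) i ∈ X i
  update_argmin : ∀ k i,
    IsMinOn (fun ξ => inner ℝ (d k i) ξ + 1 / (2 * c k) * ‖z k i - ξ‖ ^ 2) (X i) (x (k + 1) i)

/-- The step size `c(k) = η / √(k + 1)`. -/
def stepSize (η : ℝ) (k : ℕ) : ℝ := η / √((k : ℝ) + 1)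

/-- `S(k) = c(1) + ⋯ + c(k)`. -/
def stepSum (c : ℕ → ℝ) (k : ℕ) : ℝ := ∑ r ∈ Finset.Icc 1 k, c r

/-- The weighted running average of a sequence `y`, started at `y 0`. -/
def runningAverage {n : ℕ} (c : ℕ → ℝ) (y : ℕ → EuclideanSpace ℝ (Fin n)) :
    ℕ → EuclideanSpace ℝ (Fin n)
  | 0 => y 0
  | k + 1 => (stepSum c (k + 1))⁻¹ •
      (c (k + 1) • y (k + 1) + stepSum c k • runningAverage c y k)

end DistributedSubgradient

end

/-!
Let `δ k` be the diameter of the agents' states at time `k`, and `ε k` the distance by which the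
proximal step moves the averaged states. Over any window of `m * T` steps the product of the weight
matrices has all entries at least `θ ^ (m * T)`, so it contracts the diameter up to the accumulated
`ε`, and hence `∑ δ ^ 2 ≤ C₁ + C₂ * ∑ ε ^ 2`.

As the feasible set has an interior point, near the states there is a feasible point `w k` at
distance at most `K * δ k` from each of them. For a minimiser `p`, the proximal inequality and
convexity make `∑ i, ‖x k i - p‖ ^ 2` decrease at each step by at least
`ε k ^ 2 + 2 * c k * (f (w k) - f p)`, up to an error of order `c k * (δ k + ε k)`. Young's
inequality and the bound on `∑ δ ^ 2` absorb this error, so that `∑ ε ^ 2`, `∑ c * (f (w k) - f p)`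
and `∑ c * δ` are all bounded by a constant multiple of `1 + ∑ c ^ 2`, which is of order `log k`.
Dividing by `S k`, which is of order `√k`, and using convexity gives the rates for the running
averages.
-/

namespace DistributedSubgradient

open Matrix (colStochastic nonneg_of_mem_colStochastic sum_col_of_mem_colStochastic)

section WeightedAverage

theorem norm_sub_le_diam_range {ι E : Type*} [Finite ι] [SeminormedAddCommGroup E] (y : ι → E)
    (i j : ι) : ‖y i - y j‖ ≤ Metric.diam (Set.range y) :=
  dist_eq_norm (y i) (y j) ▸ Metric.dist_le_diam_of_mem (Set.finite_range y).isBounded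
    (Set.mem_range_self i) (Set.mem_range_self j)

variable {ι E : Type*} [Fintype ι] [NormedAddCommGroup E] [NormedSpace ℝ E]

theorem norm_sum_smul_sub_le {a : ι → ℝ} (ha : ∀ j, 0 ≤ a j) (ha₁ : ∑ j, a j = 1) {y : ι → E}
    {q : E} {b : ℝ} (hy : ∀ j, ‖y j - q‖ ≤ b) : ‖∑ j, a j • y j - q‖ ≤ b :=
  mem_closedBall_iff_norm.1 <| (convex_closedBall q b).sum_mem (fun j _ => ha j) ha₁
    fun j _ => mem_closedBall_iff_norm.2 (hy j)

theorem sq_norm_sum_smul_sub_le {a : ι → ℝ} (ha : ∀ j, 0 ≤ a j) (ha₁ : ∑ j, a j = 1) (y : ι → E)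
    (q : E) : ‖∑ j, a j • y j - q‖ ^ 2 ≤ ∑ j, a j * ‖y j - q‖ ^ 2 := by
  have hconv : ConvexOn ℝ Set.univ fun v : E => ‖v - q‖ ^ 2 := by
    simp_rw [← dist_eq_norm]
    exact (convexOn_dist q convex_univ).pow (fun _ _ => dist_nonneg) 2
  simpa using hconv.map_sum_le (fun j _ => ha j) ha₁ fun j _ => Set.mem_univ (y j)

theorem norm_sum_smul_sub_sum_smul_le (y : ι → E) {a b : ι → ℝ} {σ : ℝ} (ha : ∀ j, 0 ≤ a j)
    (hb : ∀ j, 0 ≤ b j) (haσ : ∑ j, a j = σ) (hbσ : ∑ j, b j = σ) :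
    ‖∑ j, a j • y j - ∑ j, b j • y j‖ ≤ σ * Metric.diam (Set.range y) := by
  rcases (haσ ▸ Finset.sum_nonneg fun j _ => ha j : 0 ≤ σ).eq_or_lt with rfl | hσ
  · have ha₀ := (Finset.sum_eq_zero_iff_of_nonneg fun j _ => ha j).1 haσ
    have hb₀ := (Finset.sum_eq_zero_iff_of_nonneg fun j _ => hb j).1 hbσ
    simp_all
  · have smul_centerMass {p : ι → ℝ} (hp : ∑ j, p j = σ) :
        ∑ j, p j • y j = σ • Finset.univ.centerMass p y := by
      rw [Finset.centerMass, hp, smul_inv_smul₀ hσ.ne']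
    have centerMass_mem {p : ι → ℝ} (hp : ∀ j, 0 ≤ p j) (hpσ : ∑ j, p j = σ) :
        Finset.univ.centerMass p y ∈ convexHull ℝ (Set.range y) :=
      Finset.univ.centerMass_mem_convexHull (fun j _ => hp j) (hpσ ▸ hσ)
        fun j _ => Set.mem_range_self j
    rw [smul_centerMass haσ, smul_centerMass hbσ, ← smul_sub, norm_smul, Real.norm_of_nonneg hσ.le,
      ← dist_eq_norm, ← convexHull_diam]
    gcongr
    exact Metric.dist_le_diam_of_mem (isBounded_convexHull.2 (Set.finite_range y).isBounded)
      (centerMass_mem ha haσ) (centerMass_mem hb hbσ)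

-- Doeblin's argument: the mass `β` which both weights put on `y o` cancels.
theorem norm_sum_smul_sub_sum_smul_le_of_le (y : ι → E) {a b : ι → ℝ} (ha : ∀ j, 0 ≤ a j)
    (hb : ∀ j, 0 ≤ b j) (ha₁ : ∑ j, a j = 1) (hb₁ : ∑ j, b j = 1) {o : ι} {β : ℝ} (hao : β ≤ a o)
    (hbo : β ≤ b o) :
    ‖∑ j, a j • y j - ∑ j, b j • y j‖ ≤ (1 - β) * Metric.diam (Set.range y) := by
  classical
  have nonneg {p : ι → ℝ} (hp : ∀ j, 0 ≤ p j) (hpo : β ≤ p o) (j : ι) :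
      0 ≤ (p - Pi.single o β : ι → ℝ) j := by
    rcases eq_or_ne j o with rfl | hj <;> simp_all
  have sum_eq {p : ι → ℝ} (hp : ∑ j, p j = 1) : ∑ j, (p - Pi.single o β : ι → ℝ) j = 1 - β := by
    simp [Finset.sum_sub_distrib, hp]
  simpa [sub_smul, Finset.sum_sub_distrib] using
    norm_sum_smul_sub_sum_smul_le y (nonneg ha hao) (nonneg hb hbo) (sum_eq ha₁) (sum_eq hb₁)

end WeightedAverage

section Transition

variable {ι : Type*} [Fintype ι]

theorem apply_mul_apply_le_mul_apply {M N : Matrix ι ι ℝ} (hM : ∀ j i, 0 ≤ M j i)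
    (hN : ∀ j i, 0 ≤ N j i) (j l i : ι) : M j l * N l i ≤ (M * N) j i := by
  rw [Matrix.mul_apply]
  exact Finset.single_le_sum (f := fun l => M j l * N l i)
    (fun l _ => mul_nonneg (hM j l) (hN l i)) (Finset.mem_univ l)

variable [DecidableEq ι] {A : ℕ → Matrix ι ι ℝ}

/-- The product `A s * A (s + 1) * ⋯ * A (s + t - 1)` of the weight matrices over the time window
from `s` to `s + t`: its entry in row `j` and column `i` is the weight of the state of `j` at
time `s` in the state of `i` at time `s + t`. -/
def transition (A : ℕ → Matrix ι ι ℝ) (s : ℕ) : ℕ → Matrix ι ι ℝ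
  | 0 => 1
  | t + 1 => transition A s t * A (s + t)

theorem transition_mem_colStochastic (hA : ∀ k, A k ∈ colStochastic ℝ ι) (s t : ℕ) :
    transition A s t ∈ colStochastic ℝ ι := by
  induction t with
  | zero => exact one_mem _
  | succ t ih => exact mul_mem ih (hA _)

variable {E : Type*} [NormedAddCommGroup E] [NormedSpace ℝ E]

theorem norm_sub_sum_transition_smul_le (hA : ∀ k, A k ∈ colStochastic ℝ ι) {x : ℕ → ι → E}
    {ε : ℕ → ℝ} (hx : ∀ k i, ‖x (k + 1) i - ∑ j, A k j i • x k j‖ ≤ ε k) (s t : ℕ) (i : ι) :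
    ‖x (s + t) i - ∑ j, transition A s t j i • x s j‖ ≤ ∑ r ∈ Finset.range t, ε (s + r) := by
  induction t generalizing i with
  | zero => simp [transition, Matrix.one_apply]
  | succ t ih =>
    have sum_transition_succ : ∑ j, transition A s (t + 1) j i • x s j
        = ∑ l, A (s + t) l i • ∑ j, transition A s t j l • x s j := by
      simp_rw [transition, Matrix.mul_apply, Finset.smul_sum, Finset.sum_smul, smul_smul]
      rw [Finset.sum_comm]
      simp_rw [mul_comm]
    have propagated : ‖∑ l, A (s + t) l i • (x (s + t) l - ∑ j, transition A s t j l • x s j)‖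
        ≤ ∑ r ∈ Finset.range t, ε (s + r) := by
      simpa only [sub_zero] using norm_sum_smul_sub_le (q := (0 : E))
        (fun l => nonneg_of_mem_colStochastic (hA (s + t)))
        (sum_col_of_mem_colStochastic (hA (s + t)) i) (by simpa only [sub_zero] using ih)
    calc ‖x (s + (t + 1)) i - ∑ j, transition A s (t + 1) j i • x s j‖
        = ‖∑ l, A (s + t) l i • (x (s + t) l - ∑ j, transition A s t j l • x s j)
            + (x (s + t + 1) i - ∑ l, A (s + t) l i • x (s + t) l)‖ := by
          simp_rw [sum_transition_succ, smul_sub, Finset.sum_sub_distrib, ← add_assoc]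
          congr 1
          abel
      _ ≤ ∑ r ∈ Finset.range (t + 1), ε (s + r) := by
          rw [Finset.sum_range_succ]
          exact (norm_add_le _ _).trans (add_le_add propagated (hx _ _))

theorem diam_range_add_le (hA : ∀ k, A k ∈ colStochastic ℝ ι) {x : ℕ → ι → E} {ε : ℕ → ℝ}
    (hx : ∀ k i, ‖x (k + 1) i - ∑ j, A k j i • x k j‖ ≤ ε k) {s t : ℕ} {o : ι} {β : ℝ}
    (hβ : ∀ i, β ≤ transition A s t o i) :
    Metric.diam (Set.range (x (s + t)))
      ≤ (1 - β) * Metric.diam (Set.range (x s)) + 2 * ∑ r ∈ Finset.range t, ε (s + r) := by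
  have hΦ := transition_mem_colStochastic hA s t
  set μ : ι → E := fun i => ∑ j, transition A s t j i • x s j
  have hμ (i : ι) : ‖x (s + t) i - μ i‖ ≤ ∑ r ∈ Finset.range t, ε (s + r) :=
    norm_sub_sum_transition_smul_le hA hx s t i
  have hcontract (i i' : ι) : ‖μ i - μ i'‖ ≤ (1 - β) * Metric.diam (Set.range (x s)) :=
    norm_sum_smul_sub_sum_smul_le_of_le (x s) (fun j => nonneg_of_mem_colStochastic hΦ)
      (fun j => nonneg_of_mem_colStochastic hΦ) (sum_col_of_mem_colStochastic hΦ i)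
      (sum_col_of_mem_colStochastic hΦ i') (hβ i) (hβ i')
  have hpair (i i' : ι) : dist (x (s + t) i) (x (s + t) i')
      ≤ (1 - β) * Metric.diam (Set.range (x s)) + 2 * ∑ r ∈ Finset.range t, ε (s + r) := by
    have htriangle := dist_triangle4 (x (s + t) i) (μ i) (μ i') (x (s + t) i')
    rw [dist_comm (μ i'), dist_eq_norm _ (μ i), dist_eq_norm (μ i), dist_eq_norm _ (μ i')]
      at htriangle
    linarith [hμ i, hμ i', hcontract i i']
  refine Metric.diam_le_of_forall_dist_le (dist_nonneg.trans (hpair o o)) ?_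
  rintro _ ⟨i, rfl⟩ _ ⟨i', rfl⟩
  exact hpair i i'

end Transition

section Network

theorem mem_of_forall_reflTransGen {ι : Type*} [Fintype ι] {r : ι → ι → Prop} {R : ℕ → Set ι}
    {a : ι} (ha : a ∈ R 0) (hR : Monotone R) (hstep : ∀ p, ∀ c ∈ R p, ∀ d, r c d → d ∈ R (p + 1))
    (hr : ∀ b, Relation.ReflTransGen r a b) (b : ι) : b ∈ R (Fintype.card ι) := by
  have eq_univ_of_stationary {p : ℕ} (hp : R (p + 1) = R p) : R p = Set.univ := by
    refine Set.eq_univ_of_forall fun b => ?_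
    induction hr b with
    | refl => exact hR p.zero_le ha
    | tail _ hcd ih => exact hp ▸ hstep p _ ih _ hcd
  have univ_or_lt_ncard (p : ℕ) : R p = Set.univ ∨ p < (R p).ncard := by
    induction p with
    | zero => exact .inr ((Set.ncard_pos (Set.toFinite _)).2 ⟨a, ha⟩)
    | succ p ih =>
      rcases (hR p.le_succ).eq_or_ssubset with hp | hp
      · exact .inl (hp ▸ eq_univ_of_stationary hp.symm)
      · rcases ih with hu | hlt
        · exact .inl (Set.univ_subset_iff.1 (hu ▸ hp.subset))
        · exact .inr (Nat.lt_of_le_of_lt hlt (Set.ncard_lt_ncard hp))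
  rcases univ_or_lt_ncard (Fintype.card ι) with hu | hlt
  · exact hu ▸ Set.mem_univ b
  · have := Set.ncard_le_card (R (Fintype.card ι))
    rw [Nat.card_eq_fintype_card] at this
    omega

variable {m : ℕ} {A : ℕ → Matrix (Fin m) (Fin m) ℝ} {θ : ℝ} {T : ℕ}

namespace NetworkAssumptions

theorem mem_colStochastic (hA : NetworkAssumptions A θ T) (k : ℕ) :
    A k ∈ colStochastic ℝ (Fin m) :=
  (mem_doublyStochastic_iff_mem_rowStochastic_and_mem_colStochastic.1 (hA.doubly_stochastic k)).2

theorem pow_succ_le_transition_succ (hA : NetworkAssumptions A θ T) (hθ : 0 ≤ θ) {s t : ℕ}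
    {j l i : Fin m} (hjl : θ ^ t ≤ transition A s t j l) (hli : θ ≤ A (s + t) l i) :
    θ ^ (t + 1) ≤ transition A s (t + 1) j i := by
  have hΦ := transition_mem_colStochastic hA.mem_colStochastic s t
  calc θ ^ (t + 1) = θ ^ t * θ := pow_succ θ t
    _ ≤ transition A s t j l * A (s + t) l i :=
        mul_le_mul hjl hli hθ (nonneg_of_mem_colStochastic hΦ)
    _ ≤ transition A s (t + 1) j i :=
        apply_mul_apply_le_mul_apply (M := transition A s t) (N := A (s + t))
          (fun _ _ => nonneg_of_mem_colStochastic hΦ)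
          (fun _ _ => nonneg_of_mem_colStochastic (hA.mem_colStochastic _)) j l i

theorem pow_add_le_transition_add (hA : NetworkAssumptions A θ T) (hθ : 0 ≤ θ) {s t : ℕ}
    {j i : Fin m} (hji : θ ^ t ≤ transition A s t j i) (a : ℕ) :
    θ ^ (t + a) ≤ transition A s (t + a) j i := by
  induction a with
  | zero => exact hji
  | succ a ih => exact hA.pow_succ_le_transition_succ hθ ih (hA.diagonal_lower_bound _ _)

theorem pow_add_le_transition_add_of_edge (hA : NetworkAssumptions A θ T) (hθ : 0 ≤ θ) {s t : ℕ}
    {j l i : Fin m} (hjl : θ ^ t ≤ transition A s t j l)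
    (hli : CommunicatesInfinitelyOften A l i) :
    θ ^ (t + T) ≤ transition A s (t + T) j i := by
  obtain ⟨r, hr, hrT, hcomm⟩ := hA.bounded_communication l i hli (s + t)
  obtain ⟨a, rfl⟩ := Nat.exists_eq_add_of_le hr
  obtain ⟨b, rfl⟩ : ∃ b, T = a + 1 + b := Nat.exists_eq_add_of_le (by omega)
  have before := hA.pow_add_le_transition_add hθ hjl a
  have after := hA.pow_succ_le_transition_succ hθ before
    (hA.positive_lower_bound _ l i (by rwa [← add_assoc]))
  simpa only [add_assoc] using hA.pow_add_le_transition_add hθ after b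

theorem pow_le_transition (hA : NetworkAssumptions A θ T) (hθ : 0 ≤ θ) (s : ℕ) (j i : Fin m) :
    θ ^ (m * T) ≤ transition A s (m * T) j i := by
  let reached (p : ℕ) : Set (Fin m) := {i | θ ^ (p * T) ≤ transition A s (p * T) j i}
  have self_mem : j ∈ reached 0 := by simp [reached, transition]
  have monotone_reached : Monotone reached := monotone_nat_of_le_succ fun p l hl => by
    simpa only [reached, Set.mem_ofPred_eq, Nat.succ_mul] using
      hA.pow_add_le_transition_add hθ hl T
  have mem_of_edge (p : ℕ) (c : Fin m) (hc : c ∈ reached p) (d : Fin m)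
      (hcd : CommunicatesInfinitelyOften A c d) : d ∈ reached (p + 1) := by
    simpa only [reached, Set.mem_ofPred_eq, Nat.succ_mul] using
      hA.pow_add_le_transition_add_of_edge hθ hc hcd
  simpa [reached] using
    mem_of_forall_reflTransGen self_mem monotone_reached mem_of_edge (hA.strongly_connected j) i

end NetworkAssumptions

end Network

section Contraction

theorem sq_le_of_le_one_sub_mul_add {β u v q : ℝ} (hβ₀ : 0 < β) (hβ₁ : β ≤ 1) (hv : 0 ≤ v)
    (h : v ≤ (1 - β) * u + q) : v ^ 2 ≤ (1 - β) * u ^ 2 + q ^ 2 / β := by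
  have hconv := (even_two.convexOn_pow (𝕜 := ℝ)).2 (Set.mem_univ u) (Set.mem_univ (q / β))
    (sub_nonneg.2 hβ₁) hβ₀.le (sub_add_cancel 1 β)
  calc v ^ 2 ≤ ((1 - β) • u + β • (q / β)) ^ 2 := by
        gcongr
        rwa [smul_eq_mul, smul_eq_mul, mul_div_cancel₀ q hβ₀.ne']
    _ ≤ (1 - β) • u ^ 2 + β • (q / β) ^ 2 := hconv
    _ = (1 - β) * u ^ 2 + q ^ 2 / β := by
        simp only [smul_eq_mul]
        field_simp

theorem mul_sum_range_le_of_shift_contraction {v e : ℕ → ℝ} {β D : ℝ} {B : ℕ} (hβ : β ≤ 1)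
    (hv : ∀ k, 0 ≤ v k) (hvD : ∀ k, v k ≤ D) (h : ∀ k, v (k + B) ≤ (1 - β) * v k + e k) (N : ℕ) :
    β * ∑ k ∈ Finset.range N, v k ≤ B * D + ∑ k ∈ Finset.range (N - B), e k := by
  have hhead : ∑ k ∈ Finset.range B, v k ≤ B * D := by
    simpa using Finset.sum_le_card_nsmul (Finset.range B) v D fun k _ => hvD k
  have htail : ∑ k ∈ Finset.range (N - B), v (B + k)
      ≤ (1 - β) * ∑ k ∈ Finset.range (N - B), v k + ∑ k ∈ Finset.range (N - B), e k := by
    rw [Finset.mul_sum, ← Finset.sum_add_distrib]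
    exact Finset.sum_le_sum fun k _ => add_comm B k ▸ h k
  have hmono {n n' : ℕ} (hn : n ≤ n') : ∑ k ∈ Finset.range n, v k ≤ ∑ k ∈ Finset.range n', v k :=
    Finset.sum_le_sum_of_subset_of_nonneg (Finset.range_mono hn) fun k _ _ => hv k
  have hsplit := hmono (show N ≤ B + (N - B) by omega)
  rw [Finset.sum_range_add] at hsplit
  linarith [mul_le_mul_of_nonneg_left (hmono (N.sub_le B)) (sub_nonneg.2 hβ)]

theorem sum_range_sub_sum_window_le {u : ℕ → ℝ} (hu : ∀ k, 0 ≤ u k) (N B : ℕ) :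
    ∑ k ∈ Finset.range (N - B), ∑ r ∈ Finset.range B, u (k + r)
      ≤ B * ∑ k ∈ Finset.range N, u k := by
  have shift_le (r : ℕ) (hr : r ∈ Finset.range B) :
      ∑ k ∈ Finset.range (N - B), u (k + r) ≤ ∑ k ∈ Finset.range N, u k := by
    rw [Finset.range_eq_Ico, Finset.sum_Ico_add']
    refine Finset.sum_le_sum_of_subset_of_nonneg (fun k hk => ?_) fun k _ _ => hu k
    simp only [Finset.mem_range, Finset.mem_Ico] at hr hk ⊢
    omega
  rw [Finset.sum_comm]
  simpa using Finset.sum_le_card_nsmul (Finset.range B) _ _ shift_le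

theorem sum_sq_le_of_window_contraction {u ε : ℕ → ℝ} {β D : ℝ} {B : ℕ} (hβ₀ : 0 < β)
    (hβ₁ : β ≤ 1) (hu : ∀ k, 0 ≤ u k) (huD : ∀ k, u k ≤ D)
    (h : ∀ s, u (s + B) ≤ (1 - β) * u s + 2 * ∑ r ∈ Finset.range B, ε (s + r)) (N : ℕ) :
    ∑ k ∈ Finset.range N, u k ^ 2
      ≤ B * D ^ 2 / β + (2 * B / β) ^ 2 * ∑ k ∈ Finset.range N, ε k ^ 2 := by
  have hsq (s : ℕ) : u (s + B) ^ 2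
      ≤ (1 - β) * u s ^ 2 + 4 * B / β * ∑ r ∈ Finset.range B, ε (s + r) ^ 2 := by
    refine (sq_le_of_le_one_sub_mul_add hβ₀ hβ₁ (hu _) (h s)).trans ?_
    have hcs : (∑ r ∈ Finset.range B, ε (s + r)) ^ 2
        ≤ B * ∑ r ∈ Finset.range B, ε (s + r) ^ 2 := by
      simpa using sq_sum_le_card_mul_sum_sq (s := Finset.range B) (f := fun r => ε (s + r))
    calc (1 - β) * u s ^ 2 + (2 * ∑ r ∈ Finset.range B, ε (s + r)) ^ 2 / β
        = (1 - β) * u s ^ 2 + 4 / β * (∑ r ∈ Finset.range B, ε (s + r)) ^ 2 := by ring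
      _ ≤ (1 - β) * u s ^ 2 + 4 / β * (B * ∑ r ∈ Finset.range B, ε (s + r) ^ 2) := by gcongr
      _ = _ := by ring
  have hsum := mul_sum_range_le_of_shift_contraction hβ₁ (fun k => sq_nonneg (u k))
    (fun k => pow_le_pow_left₀ (hu k) (huD k) 2) hsq N
  have herr := sum_range_sub_sum_window_le (fun k => sq_nonneg (ε k)) N B
  calc ∑ k ∈ Finset.range N, u k ^ 2 = (β * ∑ k ∈ Finset.range N, u k ^ 2) / β := by field_simp
    _ ≤ (B * D ^ 2 + 4 * B / β * (B * ∑ k ∈ Finset.range N, ε k ^ 2)) / β := by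
        rw [← Finset.mul_sum] at hsum
        gcongr
        exact hsum.trans (by gcongr)
    _ = _ := by ring

theorem NetworkAssumptions.sum_sq_diam_range_le {m : ℕ} {A : ℕ → Matrix (Fin m) (Fin m) ℝ}
    {θ : ℝ} {T : ℕ} (hA : NetworkAssumptions A θ T) (hθ₀ : 0 < θ) (hθ₁ : θ ≤ 1) {E : Type*}
    [NormedAddCommGroup E] [NormedSpace ℝ E] {x : ℕ → Fin m → E} {ε : ℕ → ℝ} {D : ℝ}
    (hx : ∀ k i, ‖x (k + 1) i - ∑ j, A k j i • x k j‖ ≤ ε k)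
    (hxD : ∀ k, Metric.diam (Set.range (x k)) ≤ D) (N : ℕ) :
    ∑ k ∈ Finset.range N, Metric.diam (Set.range (x k)) ^ 2
      ≤ (m * T : ℕ) * D ^ 2 / θ ^ (m * T)
        + (2 * (m * T : ℕ) / θ ^ (m * T)) ^ 2 * ∑ k ∈ Finset.range N, ε k ^ 2 := by
  refine sum_sq_le_of_window_contraction (pow_pos hθ₀ _) (pow_le_one₀ hθ₀.le hθ₁)
    (fun k => Metric.diam_nonneg) hxD (fun s => ?_) N
  rcases m.eq_zero_or_pos with rfl | hm
  · simp [Set.range_eq_empty]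
  · exact diam_range_add_le hA.mem_colStochastic hx (hA.pow_le_transition hθ₀.le s ⟨0, hm⟩)

end Contraction

section Feasibility

variable {E : Type*} [NormedAddCommGroup E] [NormedSpace ℝ E]

-- Write `y = a + δ • e` with `‖e‖ ≤ 1`; the point also lies on the segment from `a` to `p + ρ • e`.
theorem lineMap_mem_of_closedBall_subset {C : Set E} (hC : Convex ℝ C) {p a y : E} {ρ δ : ℝ}
    (hρ : 0 < ρ) (hp : Metric.closedBall p ρ ⊆ C) (ha : a ∈ C) (hδ : 0 ≤ δ) (hya : ‖y - a‖ ≤ δ) :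
    AffineMap.lineMap y p (δ / (δ + ρ)) ∈ C := by
  obtain ⟨e, he, rfl⟩ : ∃ e : E, ‖e‖ ≤ 1 ∧ y = a + δ • e := by
    refine ⟨δ⁻¹ • (y - a), ?_, ?_⟩
    · rw [norm_smul, norm_inv, Real.norm_of_nonneg hδ, inv_mul_eq_div]
      exact div_le_one_of_le₀ hya hδ
    · rcases hδ.eq_or_lt with rfl | hδ
      · simpa [sub_eq_zero] using norm_le_zero_iff.1 hya
      · rw [smul_inv_smul₀ hδ.ne', add_sub_cancel]
  have hq : p + ρ • e ∈ C := hp <| by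
    rw [mem_closedBall_iff_norm, add_sub_cancel_left, norm_smul, Real.norm_of_nonneg hρ.le]
    exact mul_le_of_le_one_right hρ.le he
  have hmem := hC.lineMap_mem ha hq (t := δ / (δ + ρ))
    ⟨by positivity, div_le_one_of_le₀ (by linarith) (by positivity)⟩
  have hcoef : (1 - δ / (δ + ρ)) * δ = δ / (δ + ρ) * ρ := by
    field_simp
    ring
  convert hmem using 1
  simp only [AffineMap.lineMap_apply_module, smul_add, smul_smul, hcoef]
  abel

theorem exists_mem_iInter_norm_sub_le {ι : Type*} [Finite ι] {X : ι → Set E}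
    (hX : ∀ i, Convex ℝ (X i)) (hint : (interior (⋂ i, X i)).Nonempty)
    (hbdd : Bornology.IsBounded (⋃ i, X i)) :
    ∃ K, 0 ≤ K ∧ ∀ y : ι → E, (∀ i, y i ∈ X i) →
      ∃ w ∈ ⋂ i, X i, ∀ i, ‖y i - w‖ ≤ K * Metric.diam (Set.range y) := by
  obtain ⟨p, hp⟩ := hint
  obtain ⟨ρ, hρ, hball⟩ := Metric.nhds_basis_closedBall.mem_iff.1 (mem_interior_iff_mem_nhds.1 hp)
  rcases isEmpty_or_nonempty ι with _ | ⟨⟨o⟩⟩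
  · exact ⟨0, le_rfl, fun _ _ => ⟨p, interior_subset hp, isEmptyElim⟩⟩
  refine ⟨1 + Metric.diam (⋃ i, X i) / ρ, by positivity, fun y hy => ?_⟩
  set δ := Metric.diam (Set.range y)
  have hδ : 0 ≤ δ := Metric.diam_nonneg
  refine ⟨AffineMap.lineMap (y o) p (δ / (δ + ρ)), Set.mem_iInter.2 fun j => ?_, fun i => ?_⟩
  · exact lineMap_mem_of_closedBall_subset (hX j) hρ (hball.trans (Set.iInter_subset X j)) (hy j)
      hδ (norm_sub_le_diam_range y o j)
  have hop : dist (y o) p ≤ Metric.diam (⋃ i, X i) :=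
    Metric.dist_le_diam_of_mem hbdd (Set.mem_iUnion_of_mem o (hy o))
      (Set.mem_iUnion_of_mem o (Set.mem_iInter.1 (interior_subset hp) o))
  have hshift : ‖y o - AffineMap.lineMap (y o) p (δ / (δ + ρ))‖
      ≤ δ / ρ * Metric.diam (⋃ i, X i) := by
    rw [← dist_eq_norm, dist_left_lineMap, Real.norm_of_nonneg (by positivity)]
    gcongr
    linarith
  calc ‖y i - AffineMap.lineMap (y o) p (δ / (δ + ρ))‖
      ≤ ‖y i - y o‖ + ‖y o - AffineMap.lineMap (y o) p (δ / (δ + ρ))‖ :=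
        norm_sub_le_norm_sub_add_norm_sub ..
    _ ≤ δ + δ / ρ * Metric.diam (⋃ i, X i) := add_le_add (norm_sub_le_diam_range y i o) hshift
    _ = (1 + Metric.diam (⋃ i, X i) / ρ) * δ := by ring

end Feasibility

section Lipschitz

theorem exists_isOpen_convex_forall_lipschitzOnWith {ι E : Type*} [Finite ι]
    [NormedAddCommGroup E] [NormedSpace ℝ E] [FiniteDimensional ℝ E] {f : ι → E → ℝ}
    (hf : ∀ i, ConvexOn ℝ Set.univ (f i)) {S : Set E} (hS : Bornology.IsBounded S) :
    ∃ C, IsOpen C ∧ Convex ℝ C ∧ S ⊆ C ∧ ∃ L, ∀ i, LipschitzOnWith L (f i) C := by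
  have := Fintype.ofFinite ι
  have := FiniteDimensional.proper_real E
  obtain ⟨R, hSR⟩ := hS.subset_ball 0
  choose L hL using fun i => (hf i).locallyLipschitz.locallyLipschitzOn
    |>.exists_lipschitzOnWith_of_compact (isCompact_closedBall (0 : E) R)
  exact ⟨Metric.ball 0 R, Metric.isOpen_ball, convex_ball 0 R, hSR, Finset.univ.sup L, fun i =>
    ((hL i).mono Metric.ball_subset_closedBall).weaken (Finset.le_sup (Finset.mem_univ i))⟩

variable {n m : ℕ}

theorem norm_le_of_mem_subdifferential {f : EuclideanSpace ℝ (Fin n) → ℝ}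
    {C : Set (EuclideanSpace ℝ (Fin n))} {L : NNReal} (hf : LipschitzOnWith L f C)
    {x ξ : EuclideanSpace ℝ (Fin n)} (hC : C ∈ 𝓝 x) (hξ : ξ ∈ subdifferential f x) : ‖ξ‖ ≤ L := by
  have htendsto : Tendsto (fun t : ℝ => x + t • ξ) (𝓝[>] 0) (𝓝 x) := by
    have : Continuous fun t : ℝ => x + t • ξ := by fun_prop
    simpa using (this.tendsto 0).mono_left nhdsWithin_le_nhds
  obtain ⟨t, htC, ht⟩ := ((htendsto.eventually_mem hC).and self_mem_nhdsWithin).exists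
  rcases eq_or_ne ξ 0 with rfl | hξ₀
  · simp
  have hpos : 0 < t * ‖ξ‖ := mul_pos ht (norm_pos_iff.2 hξ₀)
  have hle : t * ‖ξ‖ * ‖ξ‖ ≤ t * ‖ξ‖ * L := calc
    t * ‖ξ‖ * ‖ξ‖ = inner ℝ ξ (x + t • ξ - x) := by
        rw [add_sub_cancel_left, inner_smul_right, real_inner_self_eq_norm_sq]
        ring
    _ ≤ f (x + t • ξ) - f x := le_sub_iff_add_le'.2 (hξ _)
    _ ≤ L * ‖x + t • ξ - x‖ :=
        (le_abs_self _).trans (hf.norm_sub_le htC (mem_of_mem_nhds hC))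
    _ = t * ‖ξ‖ * L := by
        rw [add_sub_cancel_left, norm_smul, Real.norm_of_nonneg (le_of_lt ht), mul_comm]
  exact le_of_mul_le_mul_left hle hpos

theorem sub_sub_le_inner_of_mem_subdifferential {f : EuclideanSpace ℝ (Fin n) → ℝ}
    {C : Set (EuclideanSpace ℝ (Fin n))} {L : NNReal} (hf : LipschitzOnWith L f C)
    {x w ξ : EuclideanSpace ℝ (Fin n)} (hx : x ∈ C) (hw : w ∈ C) (hξ : ξ ∈ subdifferential f x)
    (hξL : ‖ξ‖ ≤ L) (p : EuclideanSpace ℝ (Fin n)) :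
    f w - f p - 2 * L * ‖x - w‖ ≤ inner ℝ ξ (w - p) := by
  have hinner : inner ℝ ξ (x - w) ≤ L * ‖x - w‖ :=
    (real_inner_le_norm ξ _).trans (by gcongr)
  have hlip : f w - f x ≤ L * ‖x - w‖ :=
    norm_sub_rev w x ▸ (le_abs_self _).trans (hf.norm_sub_le hw hx)
  have hsubgrad : f x - inner ℝ ξ (x - p) ≤ f p := by
    rw [sub_eq_add_neg, ← inner_neg_right, neg_sub]
    exact hξ p
  rw [← sub_sub_sub_cancel_left p w x, inner_sub_right]
  linarith

theorem abs_sum_sub_objective_le {f : Fin m → EuclideanSpace ℝ (Fin n) → ℝ}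
    {S : Fin m → Set (EuclideanSpace ℝ (Fin n))} {L : NNReal}
    (hf : ∀ i, LipschitzOnWith L (f i) (S i)) {y : Fin m → EuclideanSpace ℝ (Fin n)}
    (hy : ∀ i, y i ∈ S i) {v : EuclideanSpace ℝ (Fin n)} (hv : v ∈ ⋂ i, S i) {b : ℝ}
    (hyv : ∀ i, ‖y i - v‖ ≤ b) : |∑ i, f i (y i) - objective f v| ≤ m * (L * b) := by
  rw [objective, ← Finset.sum_sub_distrib]
  calc |∑ i, (f i (y i) - f i v)| ≤ ∑ i, |f i (y i) - f i v| := Finset.abs_sum_le_sum_abs _ _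
    _ ≤ ∑ _i : Fin m, L * b := Finset.sum_le_sum fun i _ =>
        ((hf i).norm_sub_le (hy i) (Set.mem_iInter.1 hv i)).trans
          (mul_le_mul_of_nonneg_left (hyv i) L.2)
    _ = m * (L * b) := by simp

end Lipschitz

section Prox

variable {E : Type*} [NormedAddCommGroup E] [InnerProductSpace ℝ E]

-- Completing the square: the objective is `(2 * c)⁻¹ * ‖z - c • d - ξ‖ ^ 2` up to a constant.
theorem isMinOn_norm_sub_of_isMinOn_prox {X : Set E} {c : ℝ} (hc : 0 < c) {d z p : E}
    (hmin : IsMinOn (fun ξ => inner ℝ d ξ + 1 / (2 * c) * ‖z - ξ‖ ^ 2) X p) :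
    IsMinOn (fun ξ => ‖z - c • d - ξ‖) X p := by
  have hsquare (ξ : E) : ‖z - c • d - ξ‖ ^ 2 = 2 * c * (inner ℝ d ξ + 1 / (2 * c) * ‖z - ξ‖ ^ 2)
      - 2 * c * inner ℝ d z + ‖c • d‖ ^ 2 := by
    rw [sub_right_comm, norm_sub_sq_real (z - ξ), inner_smul_right, real_inner_comm,
      inner_sub_right]
    field_simp
    ring
  intro ξ hξ
  refine le_of_sq_le_sq ?_ (norm_nonneg _)
  rw [hsquare, hsquare]
  gcongr 2 * c * ?_ - _ + _
  exact hmin hξ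

theorem prox_inequality {X : Set E} (hX : Convex ℝ X) {c : ℝ} (hc : 0 < c) {d z p y : E}
    (hp : p ∈ X) (hy : y ∈ X)
    (hmin : IsMinOn (fun ξ => inner ℝ d ξ + 1 / (2 * c) * ‖z - ξ‖ ^ 2) X p) :
    ‖p - z‖ ^ 2 + 2 * c * inner ℝ d (p - y) + ‖p - y‖ ^ 2 ≤ ‖z - y‖ ^ 2 := by
  have hproj : inner ℝ (z - c • d - p) (y - p) ≤ 0 :=
    (norm_eq_iInf_iff_real_inner_le_zero hX hp).1
      ((isMinOn_norm_sub_of_isMinOn_prox hc hmin).iInf_eq hp).symm y hy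
  have hexpand : ‖z - y‖ ^ 2 = ‖p - z‖ ^ 2 + 2 * inner ℝ (z - p) (p - y) + ‖p - y‖ ^ 2 := by
    rw [← sub_add_sub_cancel z p y, norm_add_sq_real, norm_sub_rev]
  rw [sub_right_comm, ← neg_sub p y, inner_neg_right, inner_sub_left, inner_smul_left] at hproj
  simp only [conj_trivial] at hproj
  linarith

end Prox

section Run

theorem sq_norm_pi_le_sum_sq_norm {ι E : Type*} [Fintype ι] [SeminormedAddCommGroup E]
    (y : ι → E) : ‖y‖ ^ 2 ≤ ∑ i, ‖y i‖ ^ 2 := by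
  have hsum : 0 ≤ ∑ i, ‖y i‖ ^ 2 := Finset.sum_nonneg fun _ _ => sq_nonneg _
  rw [← Real.le_sqrt (norm_nonneg y) hsum, pi_norm_le_iff_of_nonneg (Real.sqrt_nonneg _)]
  exact fun i => Real.le_sqrt_of_sq_le <|
    Finset.single_le_sum (f := fun i => ‖y i‖ ^ 2) (fun _ _ => sq_nonneg _) (Finset.mem_univ i)

theorem sum_sq_norm_sum_smul_sub_le {ι E : Type*} [Fintype ι] [DecidableEq ι]
    [NormedAddCommGroup E] [NormedSpace ℝ E] {P : Matrix ι ι ℝ} (hP : P ∈ doublyStochastic ℝ ι)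
    (y : ι → E) (q : E) : ∑ i, ‖∑ j, P j i • y j - q‖ ^ 2 ≤ ∑ j, ‖y j - q‖ ^ 2 :=
  calc ∑ i, ‖∑ j, P j i • y j - q‖ ^ 2 ≤ ∑ i, ∑ j, P j i * ‖y j - q‖ ^ 2 :=
        Finset.sum_le_sum fun i _ => sq_norm_sum_smul_sub_le
          (fun _ => nonneg_of_mem_doublyStochastic hP) (sum_col_of_mem_doublyStochastic hP i) y q
    _ = ∑ j, ‖y j - q‖ ^ 2 := by
        rw [Finset.sum_comm]
        simp_rw [← Finset.sum_mul, sum_row_of_mem_doublyStochastic hP, one_mul]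

namespace IsAlgorithmRun

variable {n m : ℕ} {f : Fin m → EuclideanSpace ℝ (Fin n) → ℝ}
  {X : Fin m → Set (EuclideanSpace ℝ (Fin n))} {A : ℕ → Matrix (Fin m) (Fin m) ℝ} {c : ℕ → ℝ}
  {x z g d : ℕ → Fin m → EuclideanSpace ℝ (Fin n)}

theorem mem (h : IsAlgorithmRun f X A c x z g d) (k : ℕ) (i : Fin m) : x k i ∈ X i := by
  cases k with
  | zero => exact h.init i
  | succ k => exact h.update_mem k i

theorem norm_z_sub_le (h : IsAlgorithmRun f X A c x z g d) {k : ℕ}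
    (hA : A k ∈ colStochastic ℝ (Fin m)) {w : EuclideanSpace ℝ (Fin n)} {b : ℝ}
    (hb : ∀ j, ‖x k j - w‖ ≤ b) (i : Fin m) : ‖z k i - w‖ ≤ b := by
  rw [h.average]
  exact norm_sum_smul_sub_le (fun _ => nonneg_of_mem_colStochastic hA)
    (sum_col_of_mem_colStochastic hA i) hb

theorem norm_d_le (h : IsAlgorithmRun f X A c x z g d) {k : ℕ}
    (hA : A k ∈ colStochastic ℝ (Fin m)) {L : ℝ} (hg : ∀ j, ‖g k j‖ ≤ L) (i : Fin m) :
    ‖d k i‖ ≤ L := by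
  rw [h.average_subgradient, ← sub_zero (∑ j, A k j i • g k j)]
  exact norm_sum_smul_sub_le (fun _ => nonneg_of_mem_colStochastic hA)
    (sum_col_of_mem_colStochastic hA i) (by simpa only [sub_zero] using hg)

theorem z_mem_of_iUnion_subset (h : IsAlgorithmRun f X A c x z g d) {k : ℕ}
    (hA : A k ∈ colStochastic ℝ (Fin m)) {C : Set (EuclideanSpace ℝ (Fin n))} (hC : Convex ℝ C)
    (hXC : ⋃ i, X i ⊆ C) (i : Fin m) : z k i ∈ C := by
  rw [h.average]
  exact hC.sum_mem (fun _ _ => nonneg_of_mem_colStochastic hA) (sum_col_of_mem_colStochastic hA i)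
    fun j _ => hXC (Set.mem_iUnion_of_mem j (h.mem k j))

theorem sum_inner_d_eq (h : IsAlgorithmRun f X A c x z g d) {k : ℕ}
    (hA : A k ∈ doublyStochastic ℝ (Fin m)) (v : EuclideanSpace ℝ (Fin n)) :
    ∑ i, inner ℝ (d k i) v = ∑ i, inner ℝ (g k i) v := by
  rw [← sum_inner, ← sum_inner]
  simp_rw [h.average_subgradient]
  rw [Finset.sum_comm]
  simp_rw [← Finset.sum_smul, sum_row_of_mem_doublyStochastic hA, one_smul]

theorem sq_norm_update_add_sum_inner_d_le (h : IsAlgorithmRun f X A c x z g d)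
    (hX : ∀ i, Convex ℝ (X i)) {k : ℕ} (hA : A k ∈ doublyStochastic ℝ (Fin m)) (hc : 0 < c k)
    {p : EuclideanSpace ℝ (Fin n)} (hp : p ∈ ⋂ i, X i) :
    ‖x (k + 1) - z k‖ ^ 2 + 2 * c k * ∑ i, inner ℝ (d k i) (x (k + 1) i - p)
      + ∑ i, ‖x (k + 1) i - p‖ ^ 2 ≤ ∑ i, ‖x k i - p‖ ^ 2 := by
  calc ‖x (k + 1) - z k‖ ^ 2 + 2 * c k * ∑ i, inner ℝ (d k i) (x (k + 1) i - p)
        + ∑ i, ‖x (k + 1) i - p‖ ^ 2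
      ≤ ∑ i, (‖x (k + 1) i - z k i‖ ^ 2 + 2 * c k * inner ℝ (d k i) (x (k + 1) i - p)
          + ‖x (k + 1) i - p‖ ^ 2) := by
        rw [Finset.sum_add_distrib, Finset.sum_add_distrib, ← Finset.mul_sum]
        gcongr
        exact sq_norm_pi_le_sum_sq_norm _
    _ ≤ ∑ i, ‖z k i - p‖ ^ 2 := Finset.sum_le_sum fun i _ =>
        prox_inequality (hX i) hc (h.update_mem k i) (Set.mem_iInter.1 hp i) (h.update_argmin k i)
    _ ≤ ∑ i, ‖x k i - p‖ ^ 2 := by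
        simp_rw [h.average]
        exact sum_sq_norm_sum_smul_sub_le hA (x k) p

variable {C : Set (EuclideanSpace ℝ (Fin n))} {L : NNReal}

theorem norm_g_le (h : IsAlgorithmRun f X A c x z g d) {k : ℕ}
    (hA : A k ∈ colStochastic ℝ (Fin m)) (hC : Convex ℝ C) (hC' : IsOpen C) (hXC : ⋃ i, X i ⊆ C)
    (hf : ∀ i, LipschitzOnWith L (f i) C) (i : Fin m) : ‖g k i‖ ≤ L :=
  norm_le_of_mem_subdifferential (hf i)
    (hC'.mem_nhds (h.z_mem_of_iUnion_subset hA hC hXC i)) (h.subgradient k i)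

theorem objective_sub_sub_le_sum_inner_d (h : IsAlgorithmRun f X A c x z g d) {k : ℕ}
    (hA : A k ∈ doublyStochastic ℝ (Fin m)) (hC : Convex ℝ C) (hC' : IsOpen C)
    (hXC : ⋃ i, X i ⊆ C) (hf : ∀ i, LipschitzOnWith L (f i) C)
    {w : EuclideanSpace ℝ (Fin n)} (hw : w ∈ ⋂ i, X i) {b : ℝ} (hb : ∀ i, ‖x k i - w‖ ≤ b)
    (p : EuclideanSpace ℝ (Fin n)) :
    objective f w - objective f p - m * L * (3 * b + ‖x (k + 1) - z k‖)
      ≤ ∑ i, inner ℝ (d k i) (x (k + 1) i - p) := by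
  have hA' := (mem_doublyStochastic_iff_mem_rowStochastic_and_mem_colStochastic.1 hA).2
  have hg (i : Fin m) : ‖g k i‖ ≤ L := h.norm_g_le hA' hC hC' hXC hf i
  have hzw (i : Fin m) : ‖z k i - w‖ ≤ b := h.norm_z_sub_le hA' hb i
  have near (i : Fin m) : -(L * (‖x (k + 1) - z k‖ + b)) ≤ inner ℝ (d k i) (x (k + 1) i - w) := by
    have hxw : ‖x (k + 1) i - w‖ ≤ ‖x (k + 1) - z k‖ + b :=
      (norm_sub_le_norm_sub_add_norm_sub _ (z k i) _).trans
        (add_le_add (norm_le_pi_norm (x (k + 1) - z k) i) (hzw i))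
    exact (abs_le.1 ((abs_real_inner_le_norm _ _).trans
      (mul_le_mul (h.norm_d_le hA' hg i) hxw (norm_nonneg _) L.2))).1
  have gap (i : Fin m) : f i w - f i p - 2 * L * b ≤ inner ℝ (g k i) (w - p) := by
    refine le_trans ?_ (sub_sub_le_inner_of_mem_subdifferential (hf i)
      (h.z_mem_of_iUnion_subset hA' hC hXC i)
      (hXC (Set.mem_iUnion_of_mem i (Set.mem_iInter.1 hw i))) (h.subgradient k i) (hg i) p)
    gcongr
    exact hzw i
  calc objective f w - objective f p - m * L * (3 * b + ‖x (k + 1) - z k‖)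
      = ∑ i, (-(L * (‖x (k + 1) - z k‖ + b)) + (f i w - f i p - 2 * L * b)) := by
        simp only [objective, Finset.sum_add_distrib, Finset.sum_sub_distrib, Finset.sum_const,
          Finset.card_univ, Fintype.card_fin, nsmul_eq_mul]
        ring
    _ ≤ ∑ i, (inner ℝ (d k i) (x (k + 1) i - w) + inner ℝ (g k i) (w - p)) :=
        Finset.sum_le_sum fun i _ => add_le_add (near i) (gap i)
    _ = ∑ i, inner ℝ (d k i) (x (k + 1) i - p) := by
        rw [Finset.sum_add_distrib, ← h.sum_inner_d_eq hA, ← Finset.sum_add_distrib]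
        simp_rw [← inner_add_right, sub_add_sub_cancel]

end IsAlgorithmRun

theorem ConvexCompactProblem.exists_shadow_descent {n m : ℕ}
    {f : Fin m → EuclideanSpace ℝ (Fin n) → ℝ} {X : Fin m → Set (EuclideanSpace ℝ (Fin n))}
    (hfX : ConvexCompactProblem f X) :
    ∃ K C : ℝ, 0 ≤ K ∧ ∀ {A : ℕ → Matrix (Fin m) (Fin m) ℝ} {c : ℕ → ℝ}
      {x z g d : ℕ → Fin m → EuclideanSpace ℝ (Fin n)}, (∀ k, A k ∈ doublyStochastic ℝ (Fin m)) →
      (∀ k, 0 < c k) → IsAlgorithmRun f X A c x z g d →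
      ∃ w : ℕ → EuclideanSpace ℝ (Fin n), (∀ k, w k ∈ ⋂ i, X i) ∧
        (∀ k i, ‖x k i - w k‖ ≤ K * Metric.diam (Set.range (x k))) ∧
        ∀ p ∈ ⋂ i, X i, ∀ k,
          ‖x (k + 1) - z k‖ ^ 2 + 2 * (c k * (objective f (w k) - objective f p))
              + ∑ i, ‖x (k + 1) i - p‖ ^ 2
            ≤ ∑ i, ‖x k i - p‖ ^ 2
              + 2 * c k * (C * (Metric.diam (Set.range (x k)) + ‖x (k + 1) - z k‖)) := by
  have hbdd := (isCompact_iUnion hfX.compact_constraint).isBounded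
  obtain ⟨K, hK, hnear⟩ :=
    exists_mem_iInter_norm_sub_le hfX.convex_constraint hfX.interior_nonempty hbdd
  obtain ⟨C, hC', hC, hXC, L, hL⟩ :=
    exists_isOpen_convex_forall_lipschitzOnWith hfX.convex_objective hbdd
  refine ⟨K, m * L * (3 * K + 1), hK, fun {A c x z g d} hA hc hrun => ?_⟩
  choose w hw hxw using fun k => hnear (x k) (hrun.mem k)
  refine ⟨w, hw, hxw, fun p hp k => ?_⟩
  have hstep := hrun.sq_norm_update_add_sum_inner_d_le hfX.convex_constraint (hA k) (hc k) hp
  have hgap := hrun.objective_sub_sub_le_sum_inner_d (hA k) hC hC' hXC hL (hw k) (hxw k) p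
  have herr : 3 * (K * Metric.diam (Set.range (x k))) + ‖x (k + 1) - z k‖
      ≤ (3 * K + 1) * (Metric.diam (Set.range (x k)) + ‖x (k + 1) - z k‖) := by
    have : 0 ≤ K * ‖x (k + 1) - z k‖ := by positivity
    linarith [Metric.diam_nonneg (s := Set.range (x k))]
  have hcoef : 0 ≤ 2 * c k := by linarith [hc k]
  have hgap' := mul_le_mul_of_nonneg_left
    (hgap.trans' (sub_le_sub_left (mul_le_mul_of_nonneg_left herr (by positivity)) _)) hcoef
  linarith

end Run

section Summation

-- Young's inequality, with weights chosen so that half of the `ε` term survives on the left.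
theorem half_sum_sq_add_two_mul_sum_le {c ε δ h V : ℕ → ℝ} {C C₁ C₂ D : ℝ} (hC₁ : 0 ≤ C₁)
    (hC₂ : 0 ≤ C₂) (hD : 0 ≤ D) (hV : ∀ k, 0 ≤ V k) (hV₀ : V 0 ≤ D)
    (hδ : ∀ N, ∑ k ∈ Finset.range N, δ k ^ 2 ≤ C₁ + C₂ * ∑ k ∈ Finset.range N, ε k ^ 2)
    (hdescent : ∀ k, ε k ^ 2 + 2 * h k + V (k + 1) ≤ V k + 2 * c k * (C * (δ k + ε k))) (N : ℕ) :
    (∑ k ∈ Finset.range N, ε k ^ 2) / 2 + 2 * ∑ k ∈ Finset.range N, h k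
      ≤ (D + C₁ + 4 * (C₂ + 2) * C ^ 2) * (1 + ∑ k ∈ Finset.range N, c k ^ 2) := by
  have hyoung (k : ℕ) : 3 / 4 * ε k ^ 2 + 2 * h k
      ≤ (V k - V (k + 1)) + 4 * (C₂ + 2) * C ^ 2 * c k ^ 2 + (4 * (C₂ + 1))⁻¹ * δ k ^ 2 := by
    have hδk : 2 * c k * (C * δ k)
        ≤ 4 * (C₂ + 1) * C ^ 2 * c k ^ 2 + (4 * (C₂ + 1))⁻¹ * δ k ^ 2 := by
      have : 0 ≤ (4 * (C₂ + 1))⁻¹ * (4 * (C₂ + 1) * (C * c k) - δ k) ^ 2 := by positivity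
      field_simp at this ⊢
      linarith
    linarith [hdescent k, sq_nonneg (2 * (C * c k) - 1 / 2 * ε k)]
  have hsum : 3 / 4 * ∑ k ∈ Finset.range N, ε k ^ 2 + 2 * ∑ k ∈ Finset.range N, h k
      ≤ (V 0 - V N) + 4 * (C₂ + 2) * C ^ 2 * ∑ k ∈ Finset.range N, c k ^ 2
        + (4 * (C₂ + 1))⁻¹ * ∑ k ∈ Finset.range N, δ k ^ 2 := by
    simpa only [Finset.sum_add_distrib, ← Finset.mul_sum, Finset.sum_range_sub'] using
      Finset.sum_le_sum fun k (_ : k ∈ Finset.range N) => hyoung k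
  have hδN : (4 * (C₂ + 1))⁻¹ * ∑ k ∈ Finset.range N, δ k ^ 2
      ≤ C₁ + 1 / 4 * ∑ k ∈ Finset.range N, ε k ^ 2 := by
    have hε : 0 ≤ ∑ k ∈ Finset.range N, ε k ^ 2 := Finset.sum_nonneg fun _ _ => sq_nonneg _
    rw [inv_mul_le_iff₀ (by positivity)]
    have := mul_nonneg hC₂ hC₁
    linarith [hδ N]
  have hc : 0 ≤ (D + C₁) * ∑ k ∈ Finset.range N, c k ^ 2 :=
    mul_nonneg (add_nonneg hD hC₁) (Finset.sum_nonneg fun _ _ => sq_nonneg _)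
  have hC : 0 ≤ 4 * (C₂ + 2) * C ^ 2 := by positivity
  linarith [hV N]

theorem sum_mul_le_of_sum_sq_le_add_mul {ι : Type*} {s : Finset ι} {c δ ε : ι → ℝ} {C₁ C₂ G : ℝ}
    (hC₁ : 0 ≤ C₁) (hC₂ : 0 ≤ C₂) (hδ : ∑ k ∈ s, δ k ^ 2 ≤ C₁ + C₂ * ∑ k ∈ s, ε k ^ 2)
    (hε : (∑ k ∈ s, ε k ^ 2) / 2 ≤ G * (1 + ∑ k ∈ s, c k ^ 2)) :
    ∑ k ∈ s, c k * δ k ≤ (C₁ + 2 * C₂ * G + 1) * (1 + ∑ k ∈ s, c k ^ 2) := by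
  have hyoung : ∑ k ∈ s, c k * δ k ≤ ∑ k ∈ s, c k ^ 2 + ∑ k ∈ s, δ k ^ 2 := by
    rw [← Finset.sum_add_distrib]
    exact Finset.sum_le_sum fun k _ => by
      linarith [two_mul_le_add_sq (c k) (δ k), sq_nonneg (c k), sq_nonneg (δ k)]
  have hc : 0 ≤ C₁ * ∑ k ∈ s, c k ^ 2 :=
    mul_nonneg hC₁ (Finset.sum_nonneg fun _ _ => sq_nonneg _)
  linarith [mul_le_mul_of_nonneg_left hε hC₂]

end Summation

section Shadowing

variable {n m : ℕ} {f : Fin m → EuclideanSpace ℝ (Fin n) → ℝ}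
  {X : Fin m → Set (EuclideanSpace ℝ (Fin n))}

theorem IsAlgorithmRun.sum_sq_diam_range_le {A : ℕ → Matrix (Fin m) (Fin m) ℝ} {c : ℕ → ℝ}
    {x z g d : ℕ → Fin m → EuclideanSpace ℝ (Fin n)} (h : IsAlgorithmRun f X A c x z g d)
    (hX : Bornology.IsBounded (⋃ i, X i)) {θ : ℝ} (hθ₀ : 0 < θ) (hθ₁ : θ ≤ 1) {T : ℕ}
    (hA : NetworkAssumptions A θ T) (N : ℕ) :
    ∑ k ∈ Finset.range N, Metric.diam (Set.range (x k)) ^ 2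
      ≤ (m * T : ℕ) * Metric.diam (⋃ i, X i) ^ 2 / θ ^ (m * T)
        + (2 * (m * T : ℕ) / θ ^ (m * T)) ^ 2
          * ∑ k ∈ Finset.range N, ‖x (k + 1) - z k‖ ^ 2 := by
  refine hA.sum_sq_diam_range_le hθ₀ hθ₁ (fun k i => ?_) (fun k => ?_) N
  · rw [← h.average]
    exact norm_le_pi_norm (x (k + 1) - z k) i
  · exact Metric.diam_mono (Set.range_subset_iff.2 fun i => Set.mem_iUnion_of_mem i (h.mem k i)) hX

theorem IsAlgorithmRun.sum_sq_norm_init_sub_le {A : ℕ → Matrix (Fin m) (Fin m) ℝ} {c : ℕ → ℝ}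
    {x z g d : ℕ → Fin m → EuclideanSpace ℝ (Fin n)} (h : IsAlgorithmRun f X A c x z g d)
    (hX : Bornology.IsBounded (⋃ i, X i)) {p : EuclideanSpace ℝ (Fin n)} (hp : p ∈ ⋂ i, X i) :
    ∑ i, ‖x 0 i - p‖ ^ 2 ≤ m * Metric.diam (⋃ i, X i) ^ 2 := by
  have hterm (i : Fin m) : ‖x 0 i - p‖ ≤ Metric.diam (⋃ i, X i) := by
    rw [← dist_eq_norm]
    exact Metric.dist_le_diam_of_mem hX (Set.mem_iUnion_of_mem i (h.init i))
      (Set.mem_iUnion_of_mem i (Set.mem_iInter.1 hp i))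
  calc ∑ i, ‖x 0 i - p‖ ^ 2 ≤ ∑ _i : Fin m, Metric.diam (⋃ i, X i) ^ 2 := by
        gcongr with i
        exact hterm i
    _ = m * Metric.diam (⋃ i, X i) ^ 2 := by simp

theorem convexOn_objective (hf : ∀ i, ConvexOn ℝ Set.univ (f i)) :
    ConvexOn ℝ Set.univ (objective f) := by
  refine ⟨convex_univ, fun x hx y hy a b ha hb hab => ?_⟩
  simp only [objective, Finset.smul_sum]
  rw [← Finset.sum_add_distrib]
  exact Finset.sum_le_sum fun i _ => (hf i).2 hx hy ha hb hab

namespace ConvexCompactProblem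

theorem isClosed_iInter (hfX : ConvexCompactProblem f X) : IsClosed (⋂ i, X i) :=
  _root_.isClosed_iInter fun i => (hfX.compact_constraint i).isClosed

theorem exists_isOptimiser (hfX : ConvexCompactProblem f X) : ∃ p, IsOptimiser f X p := by
  rcases isEmpty_or_nonempty (Fin m) with _ | ⟨⟨o⟩⟩
  · exact ⟨0, by simp, fun x _ => by simp [objective]⟩
  have hcompact : IsCompact (⋂ i, X i) :=
    (hfX.compact_constraint o).of_isClosed_subset hfX.isClosed_iInter (Set.iInter_subset _ _)
  exact hcompact.exists_isMinOn (hfX.interior_nonempty.mono interior_subset)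
    (convexOn_objective hfX.convex_objective).locallyLipschitz.continuous.continuousOn

theorem exists_sum_mul_le (hfX : ConvexCompactProblem f X) {θ : ℝ} (hθ₀ : 0 < θ) (hθ₁ : θ ≤ 1)
    (T : ℕ) :
    ∃ M G : ℝ, 0 ≤ M ∧ 0 ≤ G ∧ ∀ {A : ℕ → Matrix (Fin m) (Fin m) ℝ} {c : ℕ → ℝ}
      {x z g d : ℕ → Fin m → EuclideanSpace ℝ (Fin n)}, NetworkAssumptions A θ T →
      (∀ k, 0 < c k) → IsAlgorithmRun f X A c x z g d →
      ∃ w : ℕ → EuclideanSpace ℝ (Fin n), (∀ k, w k ∈ ⋂ i, X i) ∧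
        (∀ i N, ∑ k ∈ Finset.range N, c k * ‖x k i - w k‖
          ≤ M * (1 + ∑ k ∈ Finset.range N, c k ^ 2)) ∧
        ∀ p, IsOptimiser f X p → ∀ N,
          ∑ k ∈ Finset.range N, c k * (objective f (w k) - objective f p)
            ≤ G * (1 + ∑ k ∈ Finset.range N, c k ^ 2) := by
  have hbdd := (isCompact_iUnion hfX.compact_constraint).isBounded
  obtain ⟨K, C, hK, hshadow⟩ := hfX.exists_shadow_descent
  set D := Metric.diam (⋃ i, X i)
  set C₁ : ℝ := (m * T : ℕ) * D ^ 2 / θ ^ (m * T)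
  set C₂ : ℝ := (2 * (m * T : ℕ) / θ ^ (m * T)) ^ 2
  set G := m * D ^ 2 + C₁ + 4 * (C₂ + 2) * C ^ 2
  have hC₁ : 0 ≤ C₁ := by positivity
  have hC₂ : 0 ≤ C₂ := by positivity
  refine ⟨K * (C₁ + 2 * C₂ * G + 1), G, by positivity, by positivity,
    fun {A c x z g d} hA hc hrun => ?_⟩
  obtain ⟨w, hw, hxw, hdescent⟩ := hshadow hA.doubly_stochastic hc hrun
  have hδ := hrun.sum_sq_diam_range_le hbdd hθ₀ hθ₁ hA
  have henergy (p) (hp : IsOptimiser f X p) := half_sum_sq_add_two_mul_sum_le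
    (V := fun k => ∑ i, ‖x k i - p‖ ^ 2) hC₁ hC₂ (by positivity) (fun k => by positivity)
    (hrun.sum_sq_norm_init_sub_le hbdd hp.1) hδ (hdescent p hp.1)
  have hgap (p) (hp : IsOptimiser f X p) (N) :
      0 ≤ ∑ k ∈ Finset.range N, c k * (objective f (w k) - objective f p) :=
    Finset.sum_nonneg fun k _ => mul_nonneg (hc k).le (sub_nonneg.2 (hp.2 _ (hw k)))
  refine ⟨w, hw, fun i N => ?_, fun p hp N => ?_⟩
  · obtain ⟨p, hp⟩ := hfX.exists_isOptimiser
    calc ∑ k ∈ Finset.range N, c k * ‖x k i - w k‖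
        ≤ ∑ k ∈ Finset.range N, c k * (K * Metric.diam (Set.range (x k))) :=
          Finset.sum_le_sum fun k _ => mul_le_mul_of_nonneg_left (hxw k i) (hc k).le
      _ = K * ∑ k ∈ Finset.range N, c k * Metric.diam (Set.range (x k)) := by
          simp only [Finset.mul_sum, mul_left_comm]
      _ ≤ K * ((C₁ + 2 * C₂ * G + 1) * (1 + ∑ k ∈ Finset.range N, c k ^ 2)) := by
          gcongr
          exact sum_mul_le_of_sum_sq_le_add_mul hC₁ hC₂ (hδ N)
            (by linarith [henergy p hp N, hgap p hp N])
      _ = _ := (mul_assoc _ _ _).symm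
  · have hε : 0 ≤ ∑ k ∈ Finset.range N, ‖x (k + 1) - z k‖ ^ 2 := by positivity
    linarith [henergy p hp N, hgap p hp N]

end ConvexCompactProblem

end Shadowing

section StepSize

theorem stepSize_pos {η : ℝ} (hη : 0 < η) (k : ℕ) : 0 < stepSize η k :=
  div_pos hη (Real.sqrt_pos.2 k.cast_add_one_pos)

theorem stepSum_pos {c : ℕ → ℝ} (hc : ∀ k, 0 < c k) {k : ℕ} (hk : 1 ≤ k) : 0 < stepSum c k :=
  Finset.sum_pos (fun r _ => hc r) (Finset.nonempty_Icc.2 hk)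

theorem mul_sqrt_le_stepSum {η : ℝ} (hη : 0 ≤ η) (k : ℕ) :
    η / 2 * √(k : ℝ) ≤ stepSum (stepSize η) k := by
  rcases k.eq_zero_or_pos with rfl | hk
  · simp [stepSum]
  have hk₁ : (1 : ℝ) ≤ k := by exact_mod_cast hk
  have hsqrt : √((k : ℝ) + 1) ≤ 2 * √(k : ℝ) :=
    Real.sqrt_le_iff.2 ⟨by positivity, by rw [mul_pow, Real.sq_sqrt k.cast_nonneg]; linarith⟩
  calc η / 2 * √(k : ℝ) = k * (η / (2 * √(k : ℝ))) := by
        nth_rewrite 2 [← Real.mul_self_sqrt k.cast_nonneg]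
        field_simp
    _ ≤ k * stepSize η k := by
        unfold stepSize
        gcongr
    _ ≤ stepSum (stepSize η) k := by
        have hterm (r : ℕ) (hr : r ∈ Finset.Icc 1 k) : stepSize η k ≤ stepSize η r := by
          unfold stepSize
          gcongr
          exact (Finset.mem_Icc.1 hr).2
        simpa [stepSum] using Finset.card_nsmul_le_sum _ _ _ hterm

theorem sum_stepSize_sq_le (η : ℝ) {k : ℕ} (hk : 1 ≤ k) :
    ∑ r ∈ Finset.range (k + 1), stepSize η r ^ 2 ≤ 2 * η ^ 2 * (1 + Real.log k) := by
  have hk₁ : (1 : ℝ) ≤ k := by exact_mod_cast hk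
  have hlog : Real.log ((k + 1 : ℕ) : ℝ) ≤ 1 + Real.log k := calc
    Real.log ((k + 1 : ℕ) : ℝ) ≤ Real.log (2 * k) :=
        Real.log_le_log (by positivity) (by push_cast; linarith)
    _ = Real.log 2 + Real.log k := Real.log_mul (by simp) (by positivity)
    _ ≤ 1 + Real.log k := by linarith [Real.log_two_lt_d9]
  calc ∑ r ∈ Finset.range (k + 1), stepSize η r ^ 2 = η ^ 2 * (harmonic (k + 1) : ℝ) := by
        simp only [harmonic, Rat.cast_sum, Finset.mul_sum]
        refine Finset.sum_congr rfl fun r _ => ?_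
        rw [stepSize, div_pow, Real.sq_sqrt (by positivity), div_eq_mul_inv]
        push_cast
        rfl
    _ ≤ η ^ 2 * (1 + Real.log ((k + 1 : ℕ) : ℝ)) := by
        gcongr
        exact harmonic_le_one_add_log _
    _ ≤ η ^ 2 * (2 * (1 + Real.log k)) := by
        gcongr
        linarith [Real.log_nonneg hk₁]
    _ = 2 * η ^ 2 * (1 + Real.log k) := by ring

theorem centerMass_stepSize_le {η M : ℝ} (hη : 0 < η) (hM : 0 ≤ M) {h : ℕ → ℝ}
    (hh : ∀ r, 0 ≤ h r) {k : ℕ} (hk : 1 ≤ k)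
    (hsum : ∑ r ∈ Finset.range (k + 1), stepSize η r * h r
      ≤ M * (1 + ∑ r ∈ Finset.range (k + 1), stepSize η r ^ 2)) :
    (Finset.Icc 1 k).centerMass (stepSize η) h
      ≤ 2 / η * (1 + 2 * η ^ 2) * M * ((1 + Real.log k) / √(k : ℝ)) := by
  have hlog : 0 ≤ Real.log k := Real.log_nonneg (by exact_mod_cast hk)
  have hnumerator : ∑ r ∈ Finset.Icc 1 k, stepSize η r * h r
      ≤ M * ((1 + 2 * η ^ 2) * (1 + Real.log k)) := calc
    _ ≤ ∑ r ∈ Finset.range (k + 1), stepSize η r * h r :=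
        Finset.sum_le_sum_of_subset_of_nonneg
          (fun r hr => Finset.mem_range_succ_iff.2 (Finset.mem_Icc.1 hr).2)
          fun r _ _ => mul_nonneg (stepSize_pos hη r).le (hh r)
    _ ≤ M * (1 + ∑ r ∈ Finset.range (k + 1), stepSize η r ^ 2) := hsum
    _ ≤ _ := by
        gcongr
        linarith [sum_stepSize_sq_le η hk]
  calc (Finset.Icc 1 k).centerMass (stepSize η) h
      = (∑ r ∈ Finset.Icc 1 k, stepSize η r * h r) / stepSum (stepSize η) k := by
        simp [Finset.centerMass, stepSum, inv_mul_eq_div]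
    _ ≤ M * ((1 + 2 * η ^ 2) * (1 + Real.log k)) / (η / 2 * √(k : ℝ)) := by
        gcongr
        exact mul_sqrt_le_stepSum hη.le k
    _ = _ := by
        field_simp

end StepSize

section RunningAverage

variable {n : ℕ} {c : ℕ → ℝ} (hc : ∀ k, 0 < c k)

include hc

theorem runningAverage_eq_centerMass (y : ℕ → EuclideanSpace ℝ (Fin n)) {k : ℕ} (hk : 1 ≤ k) :
    runningAverage c y k = (Finset.Icc 1 k).centerMass c y := by
  have stepSum_smul (k : ℕ) :
      stepSum c k • runningAverage c y k = ∑ r ∈ Finset.Icc 1 k, c r • y r := by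
    induction k with
    | zero => simp [stepSum]
    | succ k ih =>
      rw [runningAverage, smul_inv_smul₀ (stepSum_pos hc k.succ_pos).ne', ih,
        Finset.sum_Icc_succ_top k.succ_pos, add_comm]
  rw [Finset.centerMass, ← stepSum_smul, ← stepSum, inv_smul_smul₀ (stepSum_pos hc hk).ne']

theorem runningAverage_mem {y : ℕ → EuclideanSpace ℝ (Fin n)} {C : Set (EuclideanSpace ℝ (Fin n))}
    (hC : Convex ℝ C) (hy : ∀ k, y k ∈ C) (k : ℕ) : runningAverage c y k ∈ C := by
  rcases k.eq_zero_or_pos with rfl | hk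
  · exact hy 0
  rw [runningAverage_eq_centerMass hc y hk]
  exact hC.centerMass_mem (fun r _ => (hc r).le) (stepSum_pos hc hk) fun r _ => hy r

theorem map_runningAverage_le {F : EuclideanSpace ℝ (Fin n) → ℝ} (hF : ConvexOn ℝ Set.univ F)
    (y : ℕ → EuclideanSpace ℝ (Fin n)) {k : ℕ} (hk : 1 ≤ k) :
    F (runningAverage c y k) ≤ (Finset.Icc 1 k).centerMass c (F ∘ y) := by
  rw [runningAverage_eq_centerMass hc y hk]
  exact hF.map_centerMass_le (fun r _ => (hc r).le) (stepSum_pos hc hk) fun r _ => Set.mem_univ _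

theorem runningAverage_sub (y w : ℕ → EuclideanSpace ℝ (Fin n)) (k : ℕ) :
    runningAverage c (y - w) k = runningAverage c y k - runningAverage c w k := by
  rcases k.eq_zero_or_pos with rfl | hk
  · rfl
  simp only [runningAverage_eq_centerMass hc _ hk, Finset.centerMass, Pi.sub_apply, smul_sub,
    Finset.sum_sub_distrib]

end RunningAverage

section Rate

theorem isBigO_one_add_log_div_sqrt :
    (fun k : ℕ => (1 + Real.log k) / √(k : ℝ)) =O[atTop] fun k : ℕ => Real.log k / √(k : ℝ) := by
  refine IsBigO.of_bound 2 ?_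
  filter_upwards [eventually_ge_atTop 3] with k hk
  have hk' : (3 : ℝ) ≤ k := by exact_mod_cast hk
  have hlog : 1 ≤ Real.log k := by
    rw [Real.le_log_iff_exp_le (by linarith)]
    linarith [Real.exp_one_lt_d9]
  rw [Real.norm_of_nonneg (by positivity), Real.norm_of_nonneg (by positivity), mul_div_assoc']
  gcongr
  linarith

theorem tendsto_log_div_sqrt :
    Tendsto (fun k : ℕ => Real.log k / √(k : ℝ)) atTop (𝓝 0) := by
  have h := (isLittleO_log_rpow_atTop (one_half_pos (α := ℝ))).tendsto_div_nhds_zero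
  simp_rw [← Real.sqrt_eq_rpow] at h
  exact h.comp tendsto_natCast_atTop_atTop

theorem mem_of_mapClusterPt_of_tendsto_sub {α E : Type*} [AddCommGroup E] [TopologicalSpace E]
    [IsTopologicalAddGroup E] {S : Set E} (hS : IsClosed S) {l : Filter α} {y v : α → E}
    (hv : ∀ k, v k ∈ S) (hyv : Tendsto (y - v) l (𝓝 0)) {p : E} (hp : MapClusterPt p l y) :
    p ∈ S := by
  obtain ⟨U, hU, hyU⟩ := mapClusterPt_iff_ultrafilter.1 hp
  have hvU : Tendsto v U (𝓝 p) := by simpa using hyU.sub (hyv.mono_left hU)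
  exact hS.mem_of_tendsto hvU (Eventually.of_forall hv)

variable {n m : ℕ}

theorem map_runningAverage_stepSize_le {η M : ℝ} (hη : 0 < η) (hM : 0 ≤ M)
    {F : EuclideanSpace ℝ (Fin n) → ℝ} (hF : ConvexOn ℝ Set.univ F)
    {y : ℕ → EuclideanSpace ℝ (Fin n)} (hFy : ∀ r, 0 ≤ F (y r))
    (hsum : ∀ N, ∑ r ∈ Finset.range N, stepSize η r * F (y r)
      ≤ M * (1 + ∑ r ∈ Finset.range N, stepSize η r ^ 2)) {k : ℕ} (hk : 1 ≤ k) :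
    F (runningAverage (stepSize η) y k)
      ≤ 2 / η * (1 + 2 * η ^ 2) * M * ((1 + Real.log k) / √(k : ℝ)) :=
  (map_runningAverage_le (stepSize_pos hη) hF y hk).trans
    (centerMass_stepSize_le hη hM hFy hk (hsum _))

theorem ConvexCompactProblem.exists_shadow_runningAverage
    {f : Fin m → EuclideanSpace ℝ (Fin n) → ℝ} {X : Fin m → Set (EuclideanSpace ℝ (Fin n))}
    (hfX : ConvexCompactProblem f X) {η θ : ℝ} (hη : 0 < η) (hθ₀ : 0 < θ) (hθ₁ : θ ≤ 1) (T : ℕ) :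
    ∃ K M : ℝ, 0 < M ∧ ∀ {A : ℕ → Matrix (Fin m) (Fin m) ℝ}
      {x z g d : ℕ → Fin m → EuclideanSpace ℝ (Fin n)}, NetworkAssumptions A θ T →
      IsAlgorithmRun f X A (stepSize η) x z g d →
      ∃ v : ℕ → EuclideanSpace ℝ (Fin n), (∀ k, v k ∈ ⋂ i, X i) ∧ ∀ k : ℕ, 1 ≤ k →
        (∀ i, ‖runningAverage (stepSize η) (fun k => x k i) k - v k‖
          ≤ K * ((1 + Real.log k) / √(k : ℝ))) ∧
        ∀ p, IsOptimiser f X p →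
          |∑ i, f i (runningAverage (stepSize η) (fun k => x k i) k) - objective f p|
            ≤ M * ((1 + Real.log k) / √(k : ℝ)) := by
  obtain ⟨C, -, -, hXC, L, hL⟩ := exists_isOpen_convex_forall_lipschitzOnWith
    hfX.convex_objective (isCompact_iUnion hfX.compact_constraint).isBounded
  obtain ⟨M, G, hM, hG, hsum⟩ := hfX.exists_sum_mul_le hθ₀ hθ₁ T
  set a := 2 / η * (1 + 2 * η ^ 2)
  refine ⟨a * M, m * (L * (a * M)) + a * G + 1, by positivity, fun {A x z g d} hA hrun => ?_⟩
  obtain ⟨w, hw, hxw, hgap⟩ := hsum hA (stepSize_pos hη) hrun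
  have hv := runningAverage_mem (stepSize_pos hη) (convex_iInter hfX.convex_constraint) hw
  refine ⟨runningAverage (stepSize η) w, hv, fun k hk => ?_⟩
  set q := (1 + Real.log k) / √(k : ℝ)
  have hq : 0 ≤ q := by
    have := Real.log_nonneg (Nat.one_le_cast.2 hk : (1 : ℝ) ≤ k)
    positivity
  have hdist (i : Fin m) : ‖runningAverage (stepSize η) (fun k => x k i) k
      - runningAverage (stepSize η) w k‖ ≤ a * M * q := by
    rw [← runningAverage_sub (stepSize_pos hη)]
    exact map_runningAverage_stepSize_le hη hM convexOn_univ_norm (fun _ => norm_nonneg _)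
      (hxw i) hk
  refine ⟨hdist, fun p hp => ?_⟩
  have hopt : objective f (runningAverage (stepSize η) w k) - objective f p ≤ a * G * q :=
    map_runningAverage_stepSize_le (F := fun y => objective f y - objective f p) hη hG
      ((convexOn_objective hfX.convex_objective).sub (concaveOn_const _ convex_univ))
      (fun r => sub_nonneg.2 (hp.2 _ (hw r))) (hgap p hp) hk
  have hopt₀ : 0 ≤ objective f (runningAverage (stepSize η) w k) - objective f p :=
    sub_nonneg.2 (hp.2 _ (hv k))
  have hlip (i : Fin m) : LipschitzOnWith L (f i) (X i) :=
    (hL i).mono ((Set.subset_iUnion X i).trans hXC)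
  have hdisagree := abs_sum_sub_objective_le hlip (fun i => runningAverage_mem (stepSize_pos hη)
    (hfX.convex_constraint i) (fun r => hrun.mem r i) k) (hv k) hdist
  refine (abs_sub_le _ (objective f (runningAverage (stepSize η) w k)) _).trans ?_
  rw [abs_of_nonneg hopt₀]
  linarith

end Rate

end DistributedSubgradient

theorem theorem2 {n m : ℕ}
    (f : Fin m → EuclideanSpace ℝ (Fin n) → ℝ)
    (X : Fin m → Set (EuclideanSpace ℝ (Fin n)))
    (hfX : DistributedSubgradient.ConvexCompactProblem f X)
    (η : ℝ) (hη : 0 < η)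
    (θ : ℝ) (hθ : θ ∈ Set.Ioo (0 : ℝ) 1) (T : ℕ) :
    ∃ B₁ > (0 : ℝ), ∃ B₂ > (0 : ℝ),
      ∀ (A : ℕ → Matrix (Fin m) (Fin m) ℝ)
        (x z g d : ℕ → Fin m → EuclideanSpace ℝ (Fin n))
        (xhat : Fin m → ℕ → EuclideanSpace ℝ (Fin n)),
        DistributedSubgradient.NetworkAssumptions A θ T →
        DistributedSubgradient.IsAlgorithmRun f X A (DistributedSubgradient.stepSize η) x z g d →
        (∀ i, xhat i = DistributedSubgradient.runningAverage
          (DistributedSubgradient.stepSize η) (fun k => x k i)) →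
        (∀ i j,
          Tendsto (fun k : ℕ => ‖xhat i k - xhat j k‖) atTop (𝓝 0) ∧
          (fun k : ℕ => ‖xhat i k - xhat j k‖) =O[atTop]
            (fun k : ℕ => Real.log (k : ℝ) / √(k : ℝ))) ∧
        (∀ i, ∀ p : EuclideanSpace ℝ (Fin n), MapClusterPt p atTop (xhat i) → p ∈ ⋂ j, X j) ∧
        (∀ xstar : EuclideanSpace ℝ (Fin n), DistributedSubgradient.IsOptimiser f X xstar →
          ∀ k : ℕ, 1 ≤ k →
            |∑ i, f i (xhat i k) - DistributedSubgradient.objective f xstar| ≤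
              B₁ * (1 / √(k : ℝ)) + B₂ * (Real.log (k : ℝ) / √(k : ℝ))) := by
  obtain ⟨K, M, hM, hshadow⟩ := hfX.exists_shadow_runningAverage hη hθ.1 hθ.2.le T
  refine ⟨M, hM, M, hM, fun A x z g d xhat hA hrun hxhat => ?_⟩
  obtain ⟨v, hv, hbound⟩ := hshadow hA hrun
  simp_rw [← hxhat] at hbound
  have hdist (i : Fin m) : (xhat i - v) =O[atTop] fun k : ℕ => Real.log k / √(k : ℝ) := by
    refine IsBigO.trans (IsBigO.of_bound |K| ?_)
      DistributedSubgradient.isBigO_one_add_log_div_sqrt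
    filter_upwards [eventually_ge_atTop 1] with k hk
    rw [Real.norm_eq_abs, ← abs_mul]
    exact ((hbound k hk).1 i).trans (le_abs_self _)
  have hagree (i j : Fin m) : (fun k : ℕ => ‖xhat i k - xhat j k‖)
      =O[atTop] fun k : ℕ => Real.log k / √(k : ℝ) := by
    simpa using ((hdist i).sub (hdist j)).norm_left
  refine ⟨fun i j => ⟨(hagree i j).trans_tendsto DistributedSubgradient.tendsto_log_div_sqrt,
    hagree i j⟩, fun i p hp => ?_, fun p hp k hk => ?_⟩
  · exact DistributedSubgradient.mem_of_mapClusterPt_of_tendsto_sub hfX.isClosed_iInter hv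
      ((hdist i).trans_tendsto DistributedSubgradient.tendsto_log_div_sqrt) hp
  · rw [← mul_add, ← add_div]
    exact (hbound k hk).2 p hp
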